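/- Let $G$ be the complete graph with self-loops on a finite vertex set $V$ with $n=|V|$ (so that each step of the simple random walk on $G$ is uniform on $V$), and let $r\in V$. Consider the algorithm Hybrid$(G,1)$: (1) Run a simple random walk $(X_t)_{t\ge 0}$ on $G$ from $X_0=r$ until the time $\sigma$ at which the first Aldous-Broder branch is finished. Here, with $V_t=\{X_0,\dots,X_t\}$ and $\eta$ the cover time, $\sigma^{\rm out}=\inf\{t>0: X_t\notin V_{t-1}\}\wedge\eta$ and $\sigma=\inf\{t>\sigma^{\rm out}: X_t\in V_{t-1}\}\wedge\eta$. Let $T$ be the tree with vertex set $V_\sigma$ and the first-entrance edges $\{X_t,X_{t+1}\}$, $t<\sigma$, $X_{t+1}\notin V_t$. (2) Run Wilson's algorithm from the initial tree $T$: while some vertex is not in $T$, choose a vertex outside $T$ uniformly at random, run a simple random walk from it until it first hits $T$, and add the chronological loop erasure of its trajectory to $T$. The expected number of random-walk steps taken by Hybrid$(G,1)$ is $n+\Theta(\sqrt n)$. More precisely, there are constants $0<c\le C$ and $N$ such that, for every $n\ge N$ and every choice of the root $r$, the expected total number of random-walk steps lies between $n+c\sqrt n$ and $n+C\sqrt n$,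 and the expected number of steps in phase (1) lies between $c\sqrt n$ and $C\sqrt n$. Moreover, for every $n\ge 2$, the expected number of random-walk steps in phase (2) is exactly $n-2$ (and so $n+O(1)$). -/

import Mathlib

open MeasureTheory ProbabilityTheory

noncomputable section

/-- A finite undirected graph in which self-loops are allowed. -/
structure LoopGraph (V : Type*) where
  Adj : V → V → Prop
  symm : ∀ v w, Adj v w → Adj w v

/-- The complete graph with self-loops: any two (possibly equal) vertices are adjacent. -/
def LoopGraph.complete (V : Type*) : LoopGraph V where
  Adj _ _ := True
  symm _ _ h := h

/-- One step of the simple random walk on `G` from `v`: the next vertex is uniform among the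
neighbours of `v` (a self-loop makes `v` one of its own neighbours).  At a vertex that has no
neighbour the walk stays put. -/
def LoopGraph.walkStep {V : Type*} [Fintype V] (G : LoopGraph V) (v : V) : PMF V :=
  open Classical in
  if h : (Finset.univ.filter (G.Adj v)).Nonempty then
    PMF.uniformOfFinset (Finset.univ.filter (G.Adj v)) h
  else PMF.pure v

/-! ### Stopping times of the Aldous-Broder walk

A list `x` of length `t + 1` stands for the trajectory `X₀, …, X_t` observed up to time `t`.
The stopping times below are evaluated on the observed trajectory; the value `⊤` means that the
time in question has not occurred yet. -/

/-- `X_k ∉ V_{k-1} = {X₀, …, X_{k-1}}`. -/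
def IsNewAt {V : Type*} (x : List V) (k : ℕ) : Prop :=
  ∃ h : k < x.length, x[k] ∉ x.take k

/-- `X_k ∈ V_{k-1} = {X₀, …, X_{k-1}}`. -/
def IsRevisitAt {V : Type*} (x : List V) (k : ℕ) : Prop :=
  ∃ h : k < x.length, x[k] ∈ x.take k

/-- The cover time `η`. -/
def coverTime {V : Type*} (x : List V) : ℕ∞ :=
  sInf {t : ℕ∞ | ∃ k : ℕ, t = k ∧ k < x.length ∧ ∀ v : V, v ∈ x.take (k + 1)}

/-- `inf {t > s : X_t ∉ V_{t-1}} ∧ η`. -/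
def firstNewAfter {V : Type*} (x : List V) (s : ℕ∞) : ℕ∞ :=
  sInf {t : ℕ∞ | ∃ k : ℕ, t = k ∧ s < k ∧ IsNewAt x k} ⊓ coverTime x

/-- `inf {t > s : X_t ∈ V_{t-1}} ∧ η`. -/
def firstRevisitAfter {V : Type*} (x : List V) (s : ℕ∞) : ℕ∞ :=
  sInf {t : ℕ∞ | ∃ k : ℕ, t = k ∧ s < k ∧ IsRevisitAt x k} ⊓ coverTime x

/-- The time `σⁱⁿ_i` at which the `i`-th Aldous-Broder branch is finished: `σⁱⁿ_0 = 0`,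
`σᵒᵘᵗ_{i+1} = inf {t > σⁱⁿ_i : X_t ∉ V_{t-1}} ∧ η` and
`σⁱⁿ_{i+1} = inf {t > σᵒᵘᵗ_{i+1} : X_t ∈ V_{t-1}} ∧ η`. -/
def sigmaIn {V : Type*} (x : List V) : ℕ → ℕ∞
  | 0 => 0
  | i + 1 => firstRevisitAfter x (firstNewAfter x (sigmaIn x i))

/-! ### Trees and loop erasure -/

/-- A partially built tree `(V_X, E_X)`. -/
structure PartialTree (V : Type*) where
  verts : Finset V
  edges : Finset (Sym2 V)

open Classical in
/-- The tree built by Aldous-Broder along the trajectory `x`: all visited vertices, and the edges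
`{X_t, X_{t+1}}` such that `X_{t+1} ≠ X_k` for all `k ≤ t`. -/
def firstEntranceTree {V : Type*} [Fintype V] [DecidableEq V] (x : List V) : PartialTree V where
  verts := x.toFinset
  edges :=
    Finset.univ.filter fun e =>
      ∃ (t : ℕ) (h : t + 1 < x.length), x[t + 1] ∉ x.take (t + 1) ∧ e = s(x[t], x[t + 1])

/-- Append the vertex `w` to the loop-free path `p`; if `w` already lies on `p`, the loop just
created is erased, that is, `p` is cut back to its visit of `w`. -/
def loopErasedAppend {V : Type*} [DecidableEq V] (p : List V) (w : V) : List V :=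
  p.takeWhile (fun u => decide (u ≠ w)) ++ [w]

/-- The chronological loop erasure of a trajectory. -/
def loopErasure {V : Type*} [DecidableEq V] (y : List V) : List V :=
  y.foldl loopErasedAppend []

/-- `V_X ← V_X ∪ V(p)` and `E_X ← E_X ∪ E(p)` for a path `p`. -/
def PartialTree.addPath {V : Type*} [DecidableEq V] (T : PartialTree V) (p : List V) :
    PartialTree V where
  verts := T.verts ∪ p.toFinset
  edges := T.edges ∪ (List.zipWith (fun u v => s(u, v)) p p.tail).toFinset

/-! ### The algorithm `Hybrid(G, i)`

It is run as a Markov chain on configurations.  Leaving a configuration that is not halted takes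
exactly one step of a random walk; everything else (testing the stopping rule, building the tree,
choosing the next start vertex) is done within that transition and is free of charge. -/

/-- Configurations of the algorithm. -/
inductive Config (V : Type*) where
  /-- Aldous-Broder is running; `x` is the trajectory of its walk so far. -/
  | aldousBroder (x : List V)
  /-- Wilson is running; `T` is the current tree and `y` is the trajectory so far of the walk
  that builds the next branch. -/
  | wilson (T : PartialTree V) (y : List V)
  /-- The algorithm has returned `T`. -/
  | halted (T : PartialTree V)

/-- The head of Wilson's loop: return `T` if it contains every vertex; otherwise choose a
vertex outside `T` uniformly at random and start a walk there. -/
def wilsonLoop {V : Type*} [Fintype V] [DecidableEq V] (T : PartialTree V) : PMF (Config V) :=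
  if h : (Finset.univ \ T.verts).Nonempty then
    (PMF.uniformOfFinset (Finset.univ \ T.verts) h).map fun v => Config.wilson T [v]
  else PMF.pure (Config.halted T)

/-- After Wilson's walk has moved: `y` is its trajectory, `w` its present position.  If `w` is in
the tree, the loop erasure of `y` is added to the tree and the loop is entered again. -/
def wilsonUpdate {V : Type*} [Fintype V] [DecidableEq V] (T : PartialTree V) (y : List V) (w : V) :
    PMF (Config V) :=
  if w ∈ T.verts then wilsonLoop (T.addPath (loopErasure y))
  else PMF.pure (Config.wilson T y)

/-- Aldous-Broder with trajectory `x` so far: if the `i`-th branch is finished, Wilson takes over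
with the tree built so far; otherwise the walk goes on. -/
def aldousBroderUpdate {V : Type*} [Fintype V] [DecidableEq V] (i : ℕ) (x : List V) :
    PMF (Config V) :=
  open Classical in
  if sigmaIn x i ≠ ⊤ then wilsonLoop (firstEntranceTree x)
  else PMF.pure (Config.aldousBroder x)

/-- The transition law of `Hybrid(G, i)`. -/
def hybridStep {V : Type*} [Fintype V] [DecidableEq V] (G : LoopGraph V) (i : ℕ) :
    Config V → PMF (Config V)
  | .aldousBroder x =>
    match x.getLast? with
    | some v => (G.walkStep v).bind fun w => aldousBroderUpdate i (x ++ [w])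
    | none => PMF.pure (.aldousBroder x) -- no trajectory is empty
  | .wilson T y =>
    match y.getLast? with
    | some v => (G.walkStep v).bind fun w => wilsonUpdate T (y ++ [w]) w
    | none => PMF.pure (.wilson T y) -- no trajectory is empty
  | .halted T => PMF.pure (.halted T)

/-- The initial configuration of `Hybrid(G, i)` with root `r`: the walk is at `X₀ = r`. -/
def hybridInit {V : Type*} [Fintype V] [DecidableEq V] (i : ℕ) (r : V) : PMF (Config V) :=
  aldousBroderUpdate i [r]

instance {V : Type*} : MeasurableSpace (Config V) := ⊤

/-- The transition law as a kernel that reads the last configuration of the past. -/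
def hybridKernel {V : Type*} [Fintype V] [DecidableEq V] (G : LoopGraph V) (i n : ℕ) :
    Kernel (Π _ : Finset.Iic n, Config V) (Config V) where
  toFun past := (hybridStep G i (past ⟨n, Finset.mem_Iic.2 le_rfl⟩)).toMeasure
  measurable' :=
    (measurable_from_top (f := fun s : Config V => (hybridStep G i s).toMeasure)).comp
      (measurable_pi_apply _)

instance {V : Type*} [Fintype V] [DecidableEq V] (G : LoopGraph V) (i n : ℕ) :
    IsMarkovKernel (hybridKernel G i n) :=
  ⟨fun past => PMF.toMeasure.isProbabilityMeasure
    (hybridStep G i (past ⟨n, Finset.mem_Iic.2 le_rfl⟩))⟩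

/-- The law of a run of `Hybrid(G, i)` with root `r`: a probability measure on the space of
infinite sequences of configurations. -/
def hybridRun {V : Type*} [Fintype V] [DecidableEq V] (G : LoopGraph V) (i : ℕ) (r : V) :
    Measure (ℕ → Config V) :=
  Kernel.trajMeasure (X := fun _ => Config V) (hybridInit i r).toMeasure (hybridKernel G i)

/-! ### Counting random-walk steps -/

/-- The number of random-walk steps taken in a run. -/
def walkSteps {V : Type*} (ω : ℕ → Config V) : ℕ∞ :=
  {t : ℕ | ∀ T, ω t ≠ .halted T}.encard

/-- The number of random-walk steps taken in the Aldous-Broder phase of a run. -/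
def aldousBroderSteps {V : Type*} (ω : ℕ → Config V) : ℕ∞ :=
  {t : ℕ | ∃ x, ω t = .aldousBroder x}.encard

/-- The number of random-walk steps taken in the Wilson phase of a run. -/
def wilsonSteps {V : Type*} (ω : ℕ → Config V) : ℕ∞ :=
  {t : ℕ | ∃ T y, ω t = .wilson T y}.encard

/-- The expectation of a `ℕ∞`-valued quantity over the runs of `Hybrid(G, i)` with root `r`. -/
def hybridExpect {V : Type*} [Fintype V] [DecidableEq V] (G : LoopGraph V) (i : ℕ) (r : V)
    (f : (ℕ → Config V) → ℕ∞) : ENNReal :=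
  ∫⁻ ω, (f ω : ENNReal) ∂(hybridRun G i r)

end

/-! On the complete graph with loops every step is uniform on `V`, so the run is governed by a few
sizes: the number `k` of visited vertices in the Aldous-Broder phase, then the tree size `k` and the
length of the current loop-erased path. Expected step counts solve a one-step equation in these
sizes, and it suffices to exhibit functions satisfying it or an inequality version of it.

Wilson's phase has an exact solution: `treePotential n k` = n - k + n/k - 1 from a tree on `k`
vertices, corrected along a branch by `branchPotential`. Averaging it over the tree size at which
the first walk stops gives `walkPotential n k` = n - k for k ≥ 2. At k = 1 a self-loop at the root
changes nothing and any other step leads to k = 2, so the value is n - 2 from the start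
(`wilsonPotential_eq`).

The Aldous-Broder phase is a birthday problem: once the root has been left, the walk stops with
probability k/n at each step, hence after order √n steps. Piecewise linear super- and subsolutions
(`upperPotential`, `lowerPotential`) prove this.

Potentials become expectations through `tsum_hybridProb_le` and `le_tsum_hybridProb`, which
telescope the one-step inequality along the run. -/

noncomputable section

open scoped ENNReal Topology
open Filter

/-! ### Averages over a probability mass function -/

namespace PMF

/-- The average of a nonnegative function. -/
def avg {α : Type*} (p : PMF α) (F : α → ℝ≥0∞) : ℝ≥0∞ := ∑' a, p a * F a

variable {α β : Type*}

lemma avg_pure (a : α) (F : α → ℝ≥0∞) : (PMF.pure a).avg F = F a := by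
  rw [avg, tsum_eq_single a]
  · simp
  · intro b hb; simp [PMF.pure_apply, hb]

lemma avg_bind (p : PMF α) (f : α → PMF β) (F : β → ℝ≥0∞) :
    (p.bind f).avg F = p.avg fun a => (f a).avg F := by
  simp only [avg, PMF.bind_apply, ← ENNReal.tsum_mul_right, ← ENNReal.tsum_mul_left]
  rw [ENNReal.tsum_comm]
  simp only [mul_assoc]

lemma avg_map (p : PMF α) (f : α → β) (F : β → ℝ≥0∞) :
    (p.map f).avg F = p.avg (F ∘ f) := by
  rw [← PMF.bind_pure_comp, avg_bind]
  simp [avg_pure, Function.comp_def]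

lemma avg_uniformOfFinset (s : Finset α) (hs : s.Nonempty) (F : α → ℝ≥0∞) :
    (PMF.uniformOfFinset s hs).avg F = (s.card : ℝ≥0∞)⁻¹ * ∑ a ∈ s, F a := by
  rw [avg, tsum_eq_sum (s := s), Finset.mul_sum]
  · exact Finset.sum_congr rfl fun a ha => by rw [PMF.uniformOfFinset_apply_of_mem _ ha]
  · intro b hb
    rw [PMF.uniformOfFinset_apply_of_notMem _ hb, zero_mul]

lemma avg_congr {p : PMF α} {F G : α → ℝ≥0∞} (h : ∀ a ∈ p.support, F a = G a) :
    p.avg F = p.avg G := by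
  refine tsum_congr fun a => ?_
  by_cases ha : a ∈ p.support
  · rw [h a ha]
  · rw [(PMF.apply_eq_zero_iff p a).2 ha, zero_mul, zero_mul]

lemma avg_const (p : PMF α) (c : ℝ≥0∞) : p.avg (fun _ => c) = c := by
  rw [avg, ENNReal.tsum_mul_right, p.tsum_coe, one_mul]

lemma lintegral_toMeasure [MeasurableSpace α] [DiscreteMeasurableSpace α] (p : PMF α)
    (F : α → ℝ≥0∞) : ∫⁻ a, F a ∂p.toMeasure = p.avg F := by
  -- A sum of weighted point masses reduces the integral to a series without any countability of
  -- `α`.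
  have : p.toMeasure = Measure.sum fun a => p a • Measure.dirac a := by
    ext s hs
    rw [PMF.toMeasure_apply _ hs, Measure.sum_apply _ hs]
    refine tsum_congr fun a => ?_
    by_cases h : a ∈ s <;> simp [h, hs]
  rw [this, lintegral_sum_measure]
  refine tsum_congr fun a => ?_
  rw [lintegral_smul_measure, lintegral_dirac' _ (Measurable.of_discrete)]
  rfl

end PMF

/-! ### The run as a Markov chain -/

section Chain

instance {V : Type*} : DiscreteMeasurableSpace (Config V) := ⟨fun _ => trivial⟩

lemma measurable_eval_comp {V : Type*} (F : Config V → ℝ≥0∞) (t : ℕ) :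
    Measurable fun ω : ℕ → Config V => F (ω t) :=
  Measurable.of_discrete.comp (measurable_pi_apply t)

variable {V : Type*} [Fintype V] [DecidableEq V] {G : LoopGraph V} {i : ℕ} {r : V}

instance : IsProbabilityMeasure (hybridInit i r).toMeasure :=
  PMF.toMeasure.isProbabilityMeasure _

lemma lintegral_hybridRun_zero (F : Config V → ℝ≥0∞) :
    ∫⁻ ω, F (ω 0) ∂(hybridRun G i r) = (hybridInit i r).avg F := by
  have h0 : (hybridRun G i r).map (fun ω => ω 0) = (hybridInit i r).toMeasure := by
    have h1 : (hybridRun G i r).map (Preorder.frestrictLe (π := fun _ => Config V) 0) =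
        (hybridInit i r).toMeasure.map
          (MeasurableEquiv.piUnique (fun _ : Finset.Iic 0 => Config V)).symm := by
      rw [hybridRun, Kernel.trajMeasure, Measure.map_comp _ _ (by fun_prop),
        Kernel.traj_map_frestrictLe, Kernel.partialTraj_self, Measure.id_comp]
    have h2 : (fun ω : ℕ → Config V => ω 0) =
        (MeasurableEquiv.piUnique (fun _ : Finset.Iic 0 => Config V)) ∘
          (Preorder.frestrictLe (π := fun _ => Config V) 0) := by
      ext ω; rfl
    rw [h2, ← Measure.map_map (by fun_prop) (by fun_prop), h1,
      Measure.map_map (by fun_prop) (by fun_prop), MeasurableEquiv.self_comp_symm,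
      Measure.map_id]
  rw [← PMF.lintegral_toMeasure, ← h0, lintegral_map Measurable.of_discrete (by fun_prop)]

/-- This is the Markov property: `hybridKernel` reads only the last coordinate of the past, so
integrating out time `t + 1` leaves an average over one transition. -/
lemma lintegral_hybridRun_succ (F : Config V → ℝ≥0∞) (t : ℕ) :
    ∫⁻ ω, F (ω (t + 1)) ∂(hybridRun G i r) =
      ∫⁻ ω, (hybridStep G i (ω t)).avg F ∂(hybridRun G i r) := by
  have h := Kernel.map_frestrictLe_trajMeasure_compProd_eq_map_trajMeasure
    (X := fun _ => Config V) (μ₀ := (hybridInit i r).toMeasure) (κ := hybridKernel G i) (a := t)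
  have hF : Measurable F := Measurable.of_discrete
  have hF' : Measurable fun p : (Finset.Iic t → Config V) × Config V => F p.2 :=
    hF.comp measurable_snd
  have h1 := congrArg
    (fun m : Measure ((Finset.Iic t → Config V) × Config V) => ∫⁻ p, F p.2 ∂m) h
  beta_reduce at h1
  rw [Measure.lintegral_compProd hF', lintegral_map hF' (by fun_prop),
    lintegral_map hF.lintegral_kernel (by fun_prop)] at h1
  rw [hybridRun, ← h1]
  refine lintegral_congr fun ω => ?_
  exact PMF.lintegral_toMeasure _ F

/-- The probability of being in `S` at time `t`. -/
def hybridProb (G : LoopGraph V) (i : ℕ) (r : V) (S : Set (Config V)) (t : ℕ) : ℝ≥0∞ :=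
  ∫⁻ ω, S.indicator 1 (ω t) ∂(hybridRun G i r)

/-- Tonelli: a number of visits is a sum of indicators over time. -/
lemma hybridExpect_encard (S : Set (Config V)) :
    hybridExpect G i r (fun ω => {t : ℕ | ω t ∈ S}.encard) = ∑' t, hybridProb G i r S t := by
  simp only [hybridExpect, hybridProb]
  rw [← lintegral_tsum fun t => (measurable_eval_comp _ t).aemeasurable]
  refine lintegral_congr fun ω => ?_
  rw [← ENNReal.tsum_set_one, tsum_subtype {t : ℕ | ω t ∈ S} fun _ => (1 : ℝ≥0∞)]
  refine tsum_congr fun t => ?_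
  by_cases h : ω t ∈ S <;> simp [h]

lemma hybridExpect_add {S D : Set (Config V)} (h : Disjoint S D) :
    hybridExpect G i r (fun ω => {t : ℕ | ω t ∈ S ∪ D}.encard) =
      ∑' t, hybridProb G i r S t + ∑' t, hybridProb G i r D t := by
  rw [hybridExpect_encard, ← ENNReal.tsum_add]
  refine tsum_congr fun t => ?_
  rw [hybridProb, hybridProb, hybridProb, ← lintegral_add_left (measurable_eval_comp _ t)]
  refine lintegral_congr fun ω => ?_
  rw [Set.indicator_union_of_disjoint h]

/-- `I` contains the initial configuration and is closed under transitions. -/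
structure IsHybridInvariant (G : LoopGraph V) (i : ℕ) (r : V) (I : Set (Config V)) : Prop where
  init : ∀ s ∈ (hybridInit i r).support, s ∈ I
  step : ∀ s ∈ I, ∀ s' ∈ (hybridStep G i s).support, s' ∈ I

lemma IsHybridInvariant.ae_mem {I : Set (Config V)} (hI : IsHybridInvariant G i r I) (t : ℕ) :
    ∀ᵐ ω ∂(hybridRun G i r), ω t ∈ I := by
  have key : ∫⁻ ω, Iᶜ.indicator 1 (ω t) ∂(hybridRun G i r) = 0 := by
    induction t with
    | zero =>
      rw [lintegral_hybridRun_zero]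
      rw [PMF.avg_congr (G := fun _ => 0), PMF.avg_const]
      intro a ha
      simp [hI.init a ha]
    | succ t ih =>
      rw [lintegral_hybridRun_succ]
      rw [lintegral_eq_zero_iff (measurable_eval_comp _ t)] at ih
      rw [lintegral_eq_zero_iff
        (measurable_eval_comp (fun s => (hybridStep G i s).avg (Iᶜ.indicator 1)) t)]
      filter_upwards [ih] with ω hω
      have hmem : ω t ∈ I := by
        by_contra hn
        simp [hn] at hω
      rw [PMF.avg_congr (G := fun _ => 0), PMF.avg_const]
      · rfl
      · intro a ha
        simp [hI.step _ hmem a ha]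
  rw [lintegral_eq_zero_iff (measurable_eval_comp _ t)] at key
  filter_upwards [key] with ω hω
  by_contra hn
  simp [hn] at hω

/-- A potential that drops by at least one on average at every visit of `S` bounds the expected
number of visits from above. -/
lemma tsum_hybridProb_le {I S : Set (Config V)} {Φ : Config V → ℝ≥0∞}
    (hI : IsHybridInvariant G i r I)
    (h : ∀ s ∈ I, S.indicator 1 s + (hybridStep G i s).avg Φ ≤ Φ s) :
    ∑' t, hybridProb G i r S t ≤ (hybridInit i r).avg Φ := by
  have hstep : ∀ t, hybridProb G i r S t + ∫⁻ ω, Φ (ω (t + 1)) ∂(hybridRun G i r) ≤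
      ∫⁻ ω, Φ (ω t) ∂(hybridRun G i r) := by
    intro t
    rw [lintegral_hybridRun_succ, hybridProb, ← lintegral_add_left (measurable_eval_comp _ t)]
    refine lintegral_mono_ae ?_
    filter_upwards [hI.ae_mem t] with ω hω using h _ hω
  have hsum : ∀ T, ∑ t ∈ Finset.range T, hybridProb G i r S t +
      ∫⁻ ω, Φ (ω T) ∂(hybridRun G i r) ≤ (hybridInit i r).avg Φ := by
    intro T
    induction T with
    | zero => simp [lintegral_hybridRun_zero]
    | succ T ih =>
      refine le_trans ?_ ih
      rw [Finset.sum_range_succ, add_assoc]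
      gcongr
      exact hstep T
  rw [ENNReal.tsum_eq_iSup_nat]
  -- The remaining potential at time `T` is nonnegative and is dropped, so no integrability is
  -- needed.
  exact iSup_le fun T => le_self_add.trans (hsum T)

/-- A potential that drops by at most one on average, and only at the visits of `S`, bounds the
expected number of visits from below, provided it is bounded and supported on a set `D` that is
visited finitely often on average. -/
lemma le_tsum_hybridProb {I S D : Set (Config V)} {Φ : Config V → ℝ≥0∞} {C : ℝ≥0∞}
    (hI : IsHybridInvariant G i r I)
    (h : ∀ s ∈ I, Φ s ≤ S.indicator 1 s + (hybridStep G i s).avg Φ)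
    (hC : C ≠ ∞) (hD : ∀ s ∈ I, Φ s ≤ C * D.indicator 1 s)
    (hfin : ∑' t, hybridProb G i r D t ≠ ∞) :
    (hybridInit i r).avg Φ ≤ ∑' t, hybridProb G i r S t := by
  have hstep : ∀ t, ∫⁻ ω, Φ (ω t) ∂(hybridRun G i r) ≤
      hybridProb G i r S t + ∫⁻ ω, Φ (ω (t + 1)) ∂(hybridRun G i r) := by
    intro t
    rw [lintegral_hybridRun_succ, hybridProb, ← lintegral_add_left (measurable_eval_comp _ t)]
    refine lintegral_mono_ae ?_
    filter_upwards [hI.ae_mem t] with ω hω using h _ hω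
  have hsum : ∀ T, (hybridInit i r).avg Φ ≤ ∑ t ∈ Finset.range T, hybridProb G i r S t +
      ∫⁻ ω, Φ (ω T) ∂(hybridRun G i r) := by
    intro T
    induction T with
    | zero => simp [lintegral_hybridRun_zero]
    | succ T ih =>
      refine le_trans ih ?_
      rw [Finset.sum_range_succ, add_assoc]
      gcongr
      exact hstep T
  -- Here the remaining potential cannot be dropped. It is at most `C` times the probability of `D`
  -- at time `T`, the general term of a convergent series, and so it vanishes in the limit.
  have hbound : ∀ T, (hybridInit i r).avg Φ ≤ ∑' t, hybridProb G i r S t +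
      C * hybridProb G i r D T := by
    intro T
    refine (hsum T).trans (add_le_add (ENNReal.sum_le_tsum _) ?_)
    rw [hybridProb, ← lintegral_const_mul _ (measurable_eval_comp _ T)]
    refine lintegral_mono_ae ?_
    filter_upwards [hI.ae_mem T] with ω hω using hD _ hω
  have hlim : Tendsto (fun T => ∑' t, hybridProb G i r S t + C * hybridProb G i r D T) atTop
      (𝓝 (∑' t, hybridProb G i r S t + C * 0)) :=
    tendsto_const_nhds.add (ENNReal.Tendsto.const_mul
      (ENNReal.tendsto_atTop_zero_of_tsum_ne_top hfin) (Or.inr hC))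
  simpa using ge_of_tendsto' hlim hbound

end Chain

/-! ### Trajectories -/

lemma toFinset_append_singleton {V : Type*} [DecidableEq V] (x : List V) (w : V) :
    (x ++ [w]).toFinset = insert w x.toFinset := by
  ext; simp

/-! ### The stopping time of the first branch -/

section Stopping

variable {V : Type*} {x : List V} {w : V}

lemma coverTime_eq_top_iff (hx : x ≠ []) : coverTime x = ⊤ ↔ ¬ ∀ v, v ∈ x := by
  have hpos := List.length_pos_iff.2 hx
  rw [coverTime, sInf_eq_top]
  constructor
  · intro h hv
    refine ENat.natCast_ne_top (x.length - 1) (h _ ⟨x.length - 1, rfl, by omega, fun v => ?_⟩)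
    rw [Nat.sub_add_cancel hpos, List.take_length]
    exact hv v
  · rintro h _ ⟨k, -, -, hv⟩
    exact absurd (fun v => List.mem_of_mem_take (hv v)) h

/-- While the walk has not covered `V`, both caps by the cover time are infinite, and the nested
infima only ask for a first entrance at a positive time followed by a revisit. -/
lemma sigmaIn_one_eq_top_iff (hx : x ≠ []) :
    sigmaIn x 1 = ⊤ ↔ (¬ ∀ v, v ∈ x) ∧
      ¬ ∃ j k, 0 < j ∧ j < k ∧ IsNewAt x j ∧ IsRevisitAt x k := by
  rw [sigmaIn, sigmaIn, firstRevisitAfter, inf_eq_top_iff, coverTime_eq_top_iff hx, and_comm]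
  refine and_congr_right fun hc => ?_
  rw [firstNewAfter, (coverTime_eq_top_iff hx).2 hc, inf_top_eq, sInf_eq_top, not_exists]
  constructor
  · rintro h j ⟨k, hj, hjk, hnew, hrev⟩
    refine ENat.natCast_ne_top k (h _ ⟨k, rfl, sInf_lt_iff.2 ⟨j, ⟨j, rfl, ?_, hnew⟩, ?_⟩, hrev⟩)
    · exact_mod_cast hj
    · exact_mod_cast hjk
  · rintro h _ ⟨k, -, hs, hrev⟩
    obtain ⟨_, ⟨j, rfl, hj, hnew⟩, hjk⟩ := sInf_lt_iff.1 hs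
    exact absurd ⟨k, by exact_mod_cast hj, by exact_mod_cast hjk, hnew, hrev⟩ (h j)

lemma isNewAt_append_singleton {k : ℕ} :
    IsNewAt (x ++ [w]) k ↔ IsNewAt x k ∨ (k = x.length ∧ w ∉ x) := by
  rcases lt_trichotomy k x.length with h | h | h
  · have h1 : k - x.length = 0 := by omega
    simp [IsNewAt, h, List.take_append, h.ne, Nat.lt_succ_of_lt h, h1]
  · subst h; simp [IsNewAt]
  · simp [IsNewAt, h.ne', h.not_gt, (Nat.succ_le_of_lt h).not_gt]

lemma isRevisitAt_append_singleton {k : ℕ} :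
    IsRevisitAt (x ++ [w]) k ↔ IsRevisitAt x k ∨ (k = x.length ∧ w ∈ x) := by
  rcases lt_trichotomy k x.length with h | h | h
  · have h1 : k - x.length = 0 := by omega
    simp [IsRevisitAt, h, List.take_append, h.ne, Nat.lt_succ_of_lt h, h1]
  · subst h; simp [IsRevisitAt]
  · simp [IsRevisitAt, h.ne', h.not_gt, (Nat.succ_le_of_lt h).not_gt]

lemma IsNewAt.lt_length {k : ℕ} (h : IsNewAt x k) : k < x.length := h.1

lemma IsRevisitAt.lt_length {k : ℕ} (h : IsRevisitAt x k) : k < x.length := h.1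

/-- Time 0 always counts as a first entrance because `x.take 0` is empty; every later one adds a
second or further distinct vertex. -/
lemma exists_isNewAt_iff [DecidableEq V] :
    (∃ j, 0 < j ∧ IsNewAt x j) ↔ 2 ≤ x.toFinset.card := by
  induction x using List.reverseRecOn with
  | nil => simp [IsNewAt]
  | append_singleton x w ih =>
    have key : (∃ j, 0 < j ∧ IsNewAt (x ++ [w]) j) ↔
        (∃ j, 0 < j ∧ IsNewAt x j) ∨ (x ≠ [] ∧ w ∉ x) := by
      simp only [isNewAt_append_singleton, ← List.length_pos_iff]
      constructor
      · rintro ⟨j, hj, h | ⟨rfl, h⟩⟩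
        · exact Or.inl ⟨j, hj, h⟩
        · exact Or.inr ⟨hj, h⟩
      · rintro (⟨j, hj, h⟩ | ⟨h1, h2⟩)
        · exact ⟨j, hj, Or.inl h⟩
        · exact ⟨_, h1, Or.inr ⟨rfl, h2⟩⟩
    rw [key, ih, toFinset_append_singleton]
    by_cases hw : w ∈ x
    · rw [Finset.insert_eq_of_mem (List.mem_toFinset.2 hw)]; simp [hw]
    · rw [Finset.card_insert_of_notMem (by simpa using hw)]
      have : x ≠ [] ↔ 0 < x.toFinset.card := by
        rw [Finset.card_pos, List.toFinset_nonempty_iff]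
      rw [this]
      simp only [hw, not_false_eq_true, and_true]
      omega

/-- A revisit ends the branch unless the walk has never left the root, in which case it was a
self-loop there. -/
lemma sigmaIn_append_of_mem [DecidableEq V] (hx : x ≠ []) (h : sigmaIn x 1 = ⊤) (hw : w ∈ x) :
    sigmaIn (x ++ [w]) 1 = ⊤ ↔ x.toFinset.card = 1 := by
  obtain ⟨hc, hp⟩ := (sigmaIn_one_eq_top_iff hx).1 h
  have hc' : ¬ ∀ v, v ∈ x ++ [w] := fun hv => hc fun v => by
    rcases List.mem_append.1 (hv v) with h | h
    · exact h
    · rw [List.mem_singleton.1 h]; exact hw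
  have hpos : 0 < x.toFinset.card := by rwa [Finset.card_pos, List.toFinset_nonempty_iff]
  have h2 : x.toFinset.card = 1 ↔ ¬ ∃ j, 0 < j ∧ IsNewAt x j := by
    rw [exists_isNewAt_iff]; omega
  rw [sigmaIn_one_eq_top_iff (by simp), h2, and_iff_right hc', not_iff_not]
  constructor
  · rintro ⟨j, k, hj, hjk, hn, hr⟩
    rcases isNewAt_append_singleton.1 hn with hn | ⟨-, hn⟩
    · exact ⟨j, hj, hn⟩
    · exact absurd hw hn
  · rintro ⟨j, hj, hn⟩
    exact ⟨j, x.length, hj, hn.lt_length, isNewAt_append_singleton.2 (Or.inl hn),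
      isRevisitAt_append_singleton.2 (Or.inr ⟨rfl, hw⟩)⟩

/-- A new vertex creates no revisit, so it can end the phase only by completing the cover. -/
lemma sigmaIn_append_of_notMem [Fintype V] [DecidableEq V] (hx : x ≠ []) (h : sigmaIn x 1 = ⊤)
    (hw : w ∉ x) :
    sigmaIn (x ++ [w]) 1 = ⊤ ↔ x.toFinset.card + 1 ≠ Fintype.card V := by
  obtain ⟨hc, hp⟩ := (sigmaIn_one_eq_top_iff hx).1 h
  have hcard : (x ++ [w]).toFinset.card = x.toFinset.card + 1 := by
    rw [toFinset_append_singleton, Finset.card_insert_of_notMem (by simpa using hw)]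
  have hcov : (∀ v, v ∈ x ++ [w]) ↔ x.toFinset.card + 1 = Fintype.card V := by
    rw [← hcard, Finset.card_eq_iff_eq_univ, Finset.eq_univ_iff_forall]
    simp only [List.mem_toFinset]
  rw [sigmaIn_one_eq_top_iff (by simp), hcov, and_iff_left]
  rintro ⟨j, k, hj, hjk, hn, hr⟩
  rcases isRevisitAt_append_singleton.1 hr with hr | ⟨-, hr⟩
  · rcases isNewAt_append_singleton.1 hn with hn | ⟨rfl, -⟩
    · exact hp ⟨j, k, hj, hjk, hn, hr⟩
    · exact absurd hr.lt_length hjk.not_gt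
  · exact hw hr

lemma sigmaIn_singleton [Fintype V] (h2 : 2 ≤ Fintype.card V) (r : V) : sigmaIn [r] 1 = ⊤ := by
  rw [sigmaIn_one_eq_top_iff (by simp)]
  constructor
  · intro h
    have : Subsingleton V := ⟨fun a b => by
      rw [List.mem_singleton.1 (h a), List.mem_singleton.1 (h b)]⟩
    exact absurd (Fintype.card_le_one_iff_subsingleton.2 this) (by omega)
  · rintro ⟨j, k, hj, -, hn, -⟩
    exact absurd hn.lt_length (by simp; omega)

end Stopping

/-! ### Loop erasure -/

section LoopErasure

variable {V : Type*} [DecidableEq V] {y : List V} {w : V}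

lemma loopErasure_append (y : List V) (w : V) :
    loopErasure (y ++ [w]) = loopErasedAppend (loopErasure y) w := by
  simp [loopErasure]

lemma loopErasure_singleton (v : V) : loopErasure [v] = [v] := by
  simp [loopErasure, loopErasedAppend]

lemma loopErasedAppend_of_notMem {p : List V} (h : w ∉ p) : loopErasedAppend p w = p ++ [w] := by
  rw [loopErasedAppend, List.takeWhile_eq_self_iff.2]
  intro a ha
  simpa using fun e : a = w => h (e ▸ ha)

lemma loopErasedAppend_ne_nil (p : List V) : loopErasedAppend p w ≠ [] := by
  simp [loopErasedAppend]

lemma loopErasedAppend_subset {p : List V} : loopErasedAppend p w ⊆ w :: p := by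
  intro a ha
  rcases List.mem_append.1 ha with h | h
  · exact List.mem_cons_of_mem _ ((List.takeWhile_sublist _).subset h)
  · rw [List.mem_singleton.1 h]; exact List.mem_cons_self

lemma nodup_loopErasedAppend {p : List V} (hp : p.Nodup) : (loopErasedAppend p w).Nodup := by
  refine List.Nodup.append (hp.sublist (List.takeWhile_sublist _)) (List.nodup_singleton w) ?_
  intro a ha hw
  have := List.mem_takeWhile_imp ha
  simp_all

lemma nodup_loopErasure (y : List V) : (loopErasure y).Nodup := by
  induction y using List.reverseRecOn with
  | nil => simp [loopErasure]
  | append_singleton y w ih => rw [loopErasure_append]; exact nodup_loopErasedAppend ih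

lemma loopErasure_ne_nil (hy : y ≠ []) : loopErasure y ≠ [] := by
  induction y using List.reverseRecOn with
  | nil => exact absurd rfl hy
  | append_singleton y w ih => rw [loopErasure_append]; exact loopErasedAppend_ne_nil _

/-- Over the vertices of a loop-free path of length `l`, the length of the path after the loop is
erased takes each value `1, …, l` once. -/
lemma sum_length_loopErasedAppend {M : Type*} [AddCommMonoid M] {p : List V} (hp : p.Nodup)
    (g : ℕ → M) :
    ∑ w ∈ p.toFinset, g (loopErasedAppend p w).length = ∑ j ∈ Finset.range p.length, g (j + 1) := by
  induction p using List.reverseRecOn with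
  | nil => simp
  | append_singleton p u ih =>
    have hu : u ∉ p := fun h =>
      (List.nodup_append.1 hp).2.2 u h u (by simp) rfl
    have hpn : p.Nodup := hp.sublist (List.sublist_append_left _ _)
    rw [toFinset_append_singleton, Finset.sum_insert (by simpa using hu),
      List.length_append, List.length_singleton, Finset.sum_range_succ, add_comm, ← ih hpn]
    congr 1
    · refine Finset.sum_congr rfl fun w hw => ?_
      have hw' : w ∈ p := by simpa using hw
      have : ¬ ∀ a ∈ p, a ≠ w := fun h => h w hw' rfl
      rw [loopErasedAppend, loopErasedAppend, List.takeWhile_append]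
      rw [if_neg]
      intro hlen
      have := List.takeWhile_eq_self_iff.1
        ((List.takeWhile_sublist (fun u => decide (u ≠ w))).eq_of_length hlen)
      simpa using this w hw'
    · rw [loopErasedAppend, List.takeWhile_append, if_pos]
      · simp
      · rw [List.takeWhile_eq_self_iff.2]
        intro a ha
        simpa using fun e : a = u => hu (e ▸ ha)

end LoopErasure

/-! ### Transitions of `Hybrid(G, 1)` on the complete graph -/

section Transitions

variable {V : Type*} [Fintype V] [DecidableEq V]

lemma walkStep_complete {V : Type*} [Fintype V] (v : V) :
    (LoopGraph.complete V).walkStep v = PMF.uniformOfFinset Finset.univ (Finset.univ_nonempty_iff.2 ⟨v⟩) := by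
  classical
  -- The set is generalised because the nonemptiness proof inside `PMF.uniformOfFinset` depends on
  -- it.
  have h : ∀ s : Finset V, (hs : s.Nonempty) → s = Finset.univ →
      PMF.uniformOfFinset s hs = PMF.uniformOfFinset Finset.univ (Finset.univ_nonempty_iff.2 ⟨v⟩) := by
    rintro s hs rfl; rfl
  rw [LoopGraph.walkStep, dif_pos ⟨v, Finset.mem_filter.2 ⟨Finset.mem_univ v, trivial⟩⟩]
  exact h _ _ (Finset.filter_true_of_mem fun _ _ => trivial)

lemma hybridStep_aldousBroder {x : List V} (hx : x ≠ []) :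
    hybridStep (LoopGraph.complete V) 1 (.aldousBroder x) =
      (PMF.uniformOfFinset Finset.univ (Finset.univ_nonempty_iff.2 ⟨x.getLast hx⟩)).bind fun w =>
        aldousBroderUpdate 1 (x ++ [w]) := by
  rw [hybridStep, List.getLast?_eq_some_getLast hx]
  simp only [walkStep_complete]

lemma hybridStep_wilson (T : PartialTree V) {y : List V} (hy : y ≠ []) :
    hybridStep (LoopGraph.complete V) 1 (.wilson T y) =
      (PMF.uniformOfFinset Finset.univ (Finset.univ_nonempty_iff.2 ⟨y.getLast hy⟩)).bind fun w =>
        wilsonUpdate T (y ++ [w]) w := by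
  rw [hybridStep, List.getLast?_eq_some_getLast hy]
  simp only [walkStep_complete]

/-- The configurations that a run may visit. -/
def reachable : Set (Config V)
  | .aldousBroder x => x ≠ [] ∧ sigmaIn x 1 = ⊤
  | .wilson T y => y ≠ [] ∧ T.verts.Nonempty ∧ Disjoint T.verts (loopErasure y).toFinset
  | .halted _ => True

lemma wilsonLoop_support {T : PartialTree V} (hT : T.verts.Nonempty) :
    ∀ s ∈ (wilsonLoop T).support, s ∈ reachable := by
  intro s hs
  rw [wilsonLoop] at hs
  split_ifs at hs with h
  · rw [PMF.mem_support_map_iff] at hs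
    obtain ⟨v, hv, rfl⟩ := hs
    rw [PMF.mem_support_uniformOfFinset_iff] at hv
    refine ⟨by simp, hT, ?_⟩
    simpa [loopErasure_singleton] using hv
  · rw [PMF.mem_support_pure_iff] at hs
    subst hs
    trivial

lemma aldousBroderUpdate_support {x : List V} (hx : x ≠ []) :
    ∀ s ∈ (aldousBroderUpdate 1 x).support, s ∈ reachable := by
  intro s hs
  rw [aldousBroderUpdate] at hs
  split_ifs at hs with h
  · exact wilsonLoop_support (by simpa [firstEntranceTree] using hx) s hs
  · rw [PMF.mem_support_pure_iff] at hs
    subst hs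
    exact ⟨hx, not_not.1 h⟩

lemma isHybridInvariant_reachable (r : V) :
    IsHybridInvariant (LoopGraph.complete V) 1 r reachable where
  init := aldousBroderUpdate_support (by simp)
  step := by
    rintro (x | ⟨T, y⟩ | T) hs s' hs'
    · rw [hybridStep_aldousBroder hs.1, PMF.mem_support_bind_iff] at hs'
      obtain ⟨w, -, hw⟩ := hs'
      exact aldousBroderUpdate_support (by simp) s' hw
    · obtain ⟨hy, hT, hd⟩ := hs
      rw [hybridStep_wilson T hy, PMF.mem_support_bind_iff] at hs'
      obtain ⟨w, -, hw⟩ := hs'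
      rw [wilsonUpdate] at hw
      split_ifs at hw with hwT
      · exact wilsonLoop_support (hT.mono Finset.subset_union_left) s' hw
      · rw [PMF.mem_support_pure_iff] at hw
        subst hw
        refine ⟨by simp, hT, ?_⟩
        -- The new path uses only `w`, which missed the tree, and vertices of the old path.
        rw [loopErasure_append, Finset.disjoint_right]
        intro a ha haT
        rcases List.mem_cons.1 (loopErasedAppend_subset (List.mem_toFinset.1 ha)) with rfl | h
        · exact hwT haT
        · exact Finset.disjoint_right.1 hd (List.mem_toFinset.2 h) haT
    · rw [hybridStep, PMF.mem_support_pure_iff] at hs'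
      subst hs'
      trivial

/-- A potential that depends on the number of vertices visited by the Aldous-Broder walk and, in
Wilson's phase, on the size of the tree and on the length of the current loop-erased path. -/
def sizePotential (a : ℕ → ℝ≥0∞) (b : ℕ → ℕ → ℝ≥0∞) : Config V → ℝ≥0∞
  | .aldousBroder x => a x.toFinset.card
  | .wilson T y => b T.verts.card (loopErasure y).length
  | .halted _ => 0

/-- The average potential at the head of Wilson's loop, for a tree on `k` of `n` vertices. -/
def loopHeadPotential (b : ℕ → ℕ → ℝ≥0∞) (n k : ℕ) : ℝ≥0∞ := if k = n then 0 else b k 1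

variable {a : ℕ → ℝ≥0∞} {b : ℕ → ℕ → ℝ≥0∞}

/-- The random choice of the start vertex is immaterial: every fresh path has length 1. -/
lemma avg_wilsonLoop (T : PartialTree V) :
    (wilsonLoop T).avg (sizePotential a b) =
      loopHeadPotential b (Fintype.card V) T.verts.card := by
  rw [wilsonLoop, loopHeadPotential]
  have hiff : (Finset.univ \ T.verts).Nonempty ↔ T.verts.card ≠ Fintype.card V := by
    rw [Finset.sdiff_nonempty, Finset.univ_subset_iff, ne_eq, Finset.card_eq_iff_eq_univ]
  split_ifs with h1 h2 h2
  · exact absurd h2 (hiff.1 h1)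
  · rw [PMF.avg_map, PMF.avg_congr (G := fun _ => b T.verts.card 1), PMF.avg_const]
    intro v _
    simp [sizePotential, loopErasure_singleton]
  · rw [PMF.avg_pure]; rfl
  · exact absurd (hiff.2 h2) h1

lemma avg_aldousBroderUpdate (x : List V) :
    (aldousBroderUpdate 1 x).avg (sizePotential a b) =
      open Classical in
      if sigmaIn x 1 = ⊤ then a x.toFinset.card
      else loopHeadPotential b (Fintype.card V) x.toFinset.card := by
  rw [aldousBroderUpdate]
  by_cases h : sigmaIn x 1 = ⊤
  · rw [if_neg (not_not.2 h), if_pos h, PMF.avg_pure]; rfl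
  · rw [if_pos h, if_neg h, avg_wilsonLoop]; rfl

lemma avg_step_aldousBroder {x : List V} (hx : x ≠ []) (h : sigmaIn x 1 = ⊤) :
    (hybridStep (LoopGraph.complete V) 1 (.aldousBroder x)).avg (sizePotential a b) =
      (Fintype.card V : ℝ≥0∞)⁻¹ *
        (x.toFinset.card * (if x.toFinset.card = 1 then a x.toFinset.card
          else loopHeadPotential b (Fintype.card V) x.toFinset.card) +
        (Fintype.card V - x.toFinset.card : ℕ) *
          (if x.toFinset.card + 1 = Fintype.card V then
            loopHeadPotential b (Fintype.card V) (x.toFinset.card + 1)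
          else a (x.toFinset.card + 1))) := by
  rw [hybridStep_aldousBroder hx, PMF.avg_bind, PMF.avg_uniformOfFinset, Finset.card_univ,
    ← Finset.sum_add_sum_compl x.toFinset]
  congr 2
  · rw [Finset.sum_congr rfl (g := fun _ => if x.toFinset.card = 1 then a x.toFinset.card
          else loopHeadPotential b (Fintype.card V) x.toFinset.card), Finset.sum_const,
          nsmul_eq_mul]
    intro w hw
    rw [avg_aldousBroderUpdate, toFinset_append_singleton, Finset.insert_eq_of_mem hw]
    simp only [sigmaIn_append_of_mem hx h (List.mem_toFinset.1 hw)]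
  · rw [Finset.sum_congr rfl (g := fun _ => if x.toFinset.card + 1 = Fintype.card V then
            loopHeadPotential b (Fintype.card V) (x.toFinset.card + 1)
          else a (x.toFinset.card + 1)), Finset.sum_const, nsmul_eq_mul, Finset.card_compl]
    intro w hw
    rw [Finset.mem_compl] at hw
    rw [avg_aldousBroderUpdate, toFinset_append_singleton, Finset.card_insert_of_notMem hw]
    simp only [sigmaIn_append_of_notMem hx h (fun hm => hw (List.mem_toFinset.2 hm)), ne_eq,
      ite_not]

/-- The next vertex lies in the tree (the whole path is attached), on the path (it is cut back to
each shorter or equal length equally often), or is fresh (the path grows by one). Disjointness makes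
the sizes add. -/
lemma avg_step_wilson {T : PartialTree V} {y : List V} (hy : y ≠ [])
    (hd : Disjoint T.verts (loopErasure y).toFinset) :
    (hybridStep (LoopGraph.complete V) 1 (.wilson T y)).avg (sizePotential a b) =
      (Fintype.card V : ℝ≥0∞)⁻¹ *
        (T.verts.card * loopHeadPotential b (Fintype.card V)
            (T.verts.card + (loopErasure y).length) +
          (∑ j ∈ Finset.range (loopErasure y).length, b T.verts.card (j + 1) +
          (Fintype.card V - (T.verts.card + (loopErasure y).length) : ℕ) *
            b T.verts.card ((loopErasure y).length + 1))) := by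
  have hcard := List.toFinset_card_of_nodup (nodup_loopErasure y)
  rw [hybridStep_wilson T hy, PMF.avg_bind, PMF.avg_uniformOfFinset, Finset.card_univ,
    ← Finset.sum_add_sum_compl (T.verts ∪ (loopErasure y).toFinset), Finset.sum_union hd,
    add_assoc]
  congr 2
  · rw [Finset.sum_congr rfl (g := fun _ => loopHeadPotential b (Fintype.card V)
            (T.verts.card + (loopErasure y).length)), Finset.sum_const, nsmul_eq_mul]
    intro w hw
    rw [wilsonUpdate, if_pos hw, avg_wilsonLoop, loopErasure_append, loopErasedAppend_of_notMem
      fun hm => Finset.disjoint_left.1 hd hw (List.mem_toFinset.2 hm), PartialTree.addPath]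
    simp only
    rw [toFinset_append_singleton, Finset.union_insert, Finset.insert_eq_of_mem
      (Finset.mem_union_left _ hw), Finset.card_union_of_disjoint hd, hcard]
  congr 1
  · rw [← sum_length_loopErasedAppend (nodup_loopErasure y)]
    refine Finset.sum_congr rfl fun w hw => ?_
    rw [wilsonUpdate, if_neg (Finset.disjoint_right.1 hd hw), PMF.avg_pure, sizePotential,
      loopErasure_append]
  · rw [Finset.sum_congr rfl (g := fun _ => b T.verts.card ((loopErasure y).length + 1)),
      Finset.sum_const, nsmul_eq_mul, Finset.card_compl, Finset.card_union_of_disjoint hd, hcard]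
    intro w hw
    rw [Finset.mem_compl, Finset.mem_union, not_or] at hw
    rw [wilsonUpdate, if_neg hw.1, PMF.avg_pure, sizePotential, loopErasure_append,
      loopErasedAppend_of_notMem fun hm => hw.2 (List.mem_toFinset.2 hm), List.length_append,
      List.length_singleton]

lemma avg_step_halted (T : PartialTree V) :
    (hybridStep (LoopGraph.complete V) 1 (.halted T)).avg (sizePotential a b) = 0 := by
  rw [hybridStep, PMF.avg_pure]; rfl

lemma avg_hybridInit (h2 : 2 ≤ Fintype.card V) (r : V) :
    (hybridInit 1 r).avg (sizePotential a b) = a 1 := by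
  rw [hybridInit, avg_aldousBroderUpdate, if_pos (sigmaIn_singleton h2 r)]
  simp

end Transitions

/-! ### The expected number of steps as an explicit potential -/

section Potentials

/-- The expected number of steps of Wilson's algorithm on the complete graph with loops on `n`
vertices, from a tree on `k` vertices. -/
def treePotential (n k : ℕ) : ℝ := n - k + n / k - 1

/-- The expected number of steps of Wilson's algorithm still to be taken when the tree has `k`
vertices and the current loop-erased path has `m + 1`. -/
def branchPotential (n k m : ℕ) : ℝ :=
  treePotential n k - ∑ j ∈ Finset.range m, (k : ℝ) / (k + j + 1)

variable {n k m : ℕ}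

lemma branchPotential_zero : branchPotential n k 0 = treePotential n k := by
  simp [branchPotential]

lemma branchPotential_succ :
    branchPotential n k (m + 1) = branchPotential n k m - (k : ℝ) / (k + m + 1) := by
  rw [branchPotential, branchPotential, Finset.sum_range_succ]; ring

lemma treePotential_self (hn : n ≠ 0) : treePotential n n = 0 := by
  have : (n : ℝ) ≠ 0 := by exact_mod_cast hn
  rw [treePotential, div_self this]; ring

lemma sub_le_treePotential (hk : 1 ≤ k) (hkn : k ≤ n) : (n : ℝ) - k ≤ treePotential n k := by
  have h1 : (0 : ℝ) < k := by exact_mod_cast hk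
  have h2 : (k : ℝ) ≤ n := by exact_mod_cast hkn
  have : 1 ≤ (n : ℝ) / k := (one_le_div h1).2 h2
  rw [treePotential]; linarith

lemma treePotential_nonneg (hk : 1 ≤ k) (hkn : k ≤ n) : 0 ≤ treePotential n k := by
  have h2 : (k : ℝ) ≤ n := by exact_mod_cast hkn
  linarith [sub_le_treePotential hk hkn]

/-- Each correction term is at most 1. The bound keeps the potentials nonnegative, and at least 1
where a step is subtracted, so that `ENNReal.ofReal` loses nothing. -/
lemma sub_le_branchPotential (hk : 1 ≤ k) (hkn : k ≤ n) :
    (n : ℝ) - k - m ≤ branchPotential n k m := by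
  have h : ∑ j ∈ Finset.range m, (k : ℝ) / (k + j + 1) ≤ ∑ j ∈ Finset.range m, 1 := by
    refine Finset.sum_le_sum fun j _ => div_le_one_of_le₀ ?_ (by positivity)
    linarith [(Nat.cast_nonneg j : (0 : ℝ) ≤ j)]
  rw [Finset.sum_const, Finset.card_range, nsmul_eq_mul, mul_one] at h
  have := sub_le_treePotential hk hkn
  rw [branchPotential]; linarith

lemma branchPotential_nonneg (hk : 1 ≤ k) (h : k + m ≤ n) : 0 ≤ branchPotential n k m := by
  have h2 : (k : ℝ) + m ≤ n := by exact_mod_cast h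
  linarith [sub_le_branchPotential (n := n) (m := m) hk (by omega)]

lemma branchPotential_le (hk : 1 ≤ k) : branchPotential n k m ≤ 2 * n := by
  have h : 0 ≤ ∑ j ∈ Finset.range m, (k : ℝ) / (k + j + 1) :=
    Finset.sum_nonneg fun j _ => by positivity
  have h1 : (1 : ℝ) ≤ k := by exact_mod_cast hk
  have h2 : (n : ℝ) / k ≤ n := div_le_self (by positivity) h1
  rw [branchPotential, treePotential]; linarith

/-- This is the one-step equation multiplied by `n`, for a path of `m + 1` vertices. In the
difference of the equations for consecutive `m` the sum over cut-back lengths collapses to one term,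
leaving a rational identity. -/
lemma branchPotential_recurrence (hk : 1 ≤ k) (m : ℕ) :
    k * treePotential n (k + (m + 1)) +
      (∑ j ∈ Finset.range (m + 1), branchPotential n k j +
        ((n : ℝ) - (k + (m + 1))) * branchPotential n k (m + 1)) =
      n * (branchPotential n k m - 1) := by
  have hk0 : (0 : ℝ) < k := by exact_mod_cast hk
  induction m with
  | zero =>
    rw [Finset.sum_range_one, branchPotential_succ, branchPotential_zero, treePotential,
      treePotential]
    push_cast
    field_simp
    ring
  | succ m ih =>
    have hm : (0 : ℝ) ≤ m := Nat.cast_nonneg m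
    have e1 := branchPotential_succ (n := n) (k := k) (m := m)
    have e2 := branchPotential_succ (n := n) (k := k) (m := m + 1)
    rw [Finset.sum_range_succ]
    have key : k * (treePotential n (k + (m + 1 + 1)) - treePotential n (k + (m + 1))) +
        (branchPotential n k (m + 1) + ((n : ℝ) - (k + (m + 1 + 1))) *
            branchPotential n k (m + 1 + 1) -
          ((n : ℝ) - (k + (m + 1))) * branchPotential n k (m + 1)) =
        n * (branchPotential n k (m + 1) - branchPotential n k m) := by
      rw [e2, e1, treePotential, treePotential]
      push_cast
      field_simp
      ring
    push_cast at key ⊢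
    linarith

/-- The expected number of steps of Wilson's algorithm in `Hybrid(G, 1)` when the Aldous-Broder
walk has visited `k` vertices. -/
def walkPotential (n k : ℕ) : ℝ := n - max k 2

/-- An upper bound for the expected number of steps of the Aldous-Broder phase still to be taken
when the walk has visited `k` vertices. -/
def upperPotential (n k : ℕ) : ℝ := 2 * √n + 2 * max (√n + 1 - k) 0

/-- A lower bound for the expected number of steps of the Aldous-Broder phase still to be taken
when the walk has visited `k` vertices. -/
def lowerPotential (n k : ℕ) : ℝ := max (√n - k) 0 / 2

lemma one_le_sqrt_natCast (hn : 1 ≤ n) : 1 ≤ √(n : ℝ) :=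
  Real.one_le_sqrt.2 (by exact_mod_cast hn)

lemma upperPotential_nonneg : 0 ≤ upperPotential n k := by
  rw [upperPotential]; positivity

lemma upperPotential_one (hn : 1 ≤ n) : upperPotential n 1 = 4 * √n := by
  have := one_le_sqrt_natCast hn
  rw [upperPotential, max_eq_left (by push_cast; linarith)]
  push_cast; ring

/-- The slope 2 pays for the possible self-loop at the root: the gain 2(n - 1) is at least `n` once
n ≥ 2. -/
lemma upperPotential_recurrence_one (hn : 2 ≤ n) :
    n + (upperPotential n 1 + ((n : ℝ) - 1) * upperPotential n 2) ≤ n * upperPotential n 1 := by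
  have h1 := one_le_sqrt_natCast (n := n) (by omega)
  have h2 : (2 : ℝ) ≤ n := by exact_mod_cast hn
  rw [upperPotential_one (by omega), upperPotential, max_eq_left (by push_cast; linarith)]
  push_cast
  nlinarith

/-- For k ≤ √n the linear part falls by 2, more than the one step taken. Beyond √n the stopping
chance k/n acts on a potential of at least 2√n, which again exceeds one step. -/
lemma upperPotential_recurrence (hn : 1 ≤ n) :
    n + ((n : ℝ) - k) * upperPotential n (k + 1) ≤ n * upperPotential n k := by
  have h1 := one_le_sqrt_natCast hn
  have hsq : √(n : ℝ) * √n = n := Real.mul_self_sqrt (by positivity)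
  have hn0 : (1 : ℝ) ≤ n := by exact_mod_cast hn
  have hk0 : (0 : ℝ) ≤ k := Nat.cast_nonneg k
  have hU : 0 ≤ upperPotential n (k + 1) := upperPotential_nonneg
  rcases le_total (k : ℝ) √n with h | h
  · have : upperPotential n k = upperPotential n (k + 1) + 2 := by
      rw [upperPotential, upperPotential, max_eq_left (by linarith),
        max_eq_left (by push_cast; linarith)]
      push_cast; ring
    rw [this]
    nlinarith
  · have hle : upperPotential n (k + 1) ≤ upperPotential n k := by
      rw [upperPotential, upperPotential]
      gcongr
      simp
    have h2 : 2 * √(n : ℝ) ≤ upperPotential n (k + 1) := by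
      rw [upperPotential]
      linarith [le_max_right (√(n : ℝ) + 1 - (k + 1 : ℕ)) 0]
    have h3 : (n : ℝ) ≤ k * upperPotential n (k + 1) := by nlinarith
    nlinarith

lemma lowerPotential_nonneg : 0 ≤ lowerPotential n k := by
  rw [lowerPotential]; positivity

/-- Covering `V` also ends the phase, so the potential must vanish there. -/
lemma lowerPotential_self : lowerPotential n n = 0 := by
  rw [lowerPotential, max_eq_right, zero_div]
  have : √(n : ℝ) ≤ n := by
    rw [Real.sqrt_le_left (Nat.cast_nonneg n)]
    exact_mod_cast Nat.le_self_pow two_ne_zero n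
  linarith

lemma lowerPotential_le : lowerPotential n k ≤ √n := by
  have := Real.sqrt_nonneg (n : ℝ)
  have h : max (√(n : ℝ) - k) 0 ≤ √n :=
    max_le (by linarith [(Nat.cast_nonneg k : (0 : ℝ) ≤ k)]) this
  rw [lowerPotential]; linarith

lemma lowerPotential_le_succ : lowerPotential n k ≤ lowerPotential n (k + 1) + 1 / 2 := by
  have h : max (√(n : ℝ) - k) 0 ≤ max (√n - (k + 1 : ℕ)) 0 + 1 := by
    refine max_le ?_ ?_
    · have := le_max_left (√(n : ℝ) - (k + 1 : ℕ)) 0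
      push_cast at this ⊢
      linarith
    · linarith [le_max_right (√(n : ℝ) - (k + 1 : ℕ)) 0]
  rw [lowerPotential, lowerPotential]; linarith

lemma lowerPotential_recurrence_one (hn : 1 ≤ n) :
    n * lowerPotential n 1 ≤ n + (lowerPotential n 1 + ((n : ℝ) - 1) * lowerPotential n 2) := by
  have h := lowerPotential_le_succ (n := n) (k := 1)
  have h2 : (1 : ℝ) ≤ n := by exact_mod_cast hn
  nlinarith

/-- A new vertex lowers the potential by at most 1/2, and stopping costs at most another 1/2 on
average, since k(√n - k) ≤ n/4. -/
lemma lowerPotential_recurrence :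
    n * lowerPotential n k ≤ n + ((n : ℝ) - k) * lowerPotential n (k + 1) := by
  have h := lowerPotential_le_succ (n := n) (k := k)
  have hn : (0 : ℝ) ≤ n := Nat.cast_nonneg n
  have hk : (0 : ℝ) ≤ k := Nat.cast_nonneg k
  have hsq : √(n : ℝ) * √n = n := Real.mul_self_sqrt hn
  have h3 : k * lowerPotential n (k + 1) ≤ n / 2 := by
    rw [lowerPotential]
    rcases le_total (√(n : ℝ) - (k + 1 : ℕ)) 0 with h | h
    · rw [max_eq_right h]; simpa using by positivity
    · rw [max_eq_left h]
      push_cast at h ⊢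
      nlinarith [sq_nonneg (√(n : ℝ) - 2 * k)]
  nlinarith

lemma walkPotential_recurrence (hk : 2 ≤ k) :
    k * treePotential n k + ((n : ℝ) - k) * walkPotential n (k + 1) = n * walkPotential n k := by
  have h1 : (k : ℝ) ≠ 0 := by
    have : k ≠ 0 := by omega
    exact_mod_cast this
  have h2 : (2 : ℝ) ≤ k := by exact_mod_cast hk
  rw [walkPotential, walkPotential, treePotential, max_eq_left hk,
    max_eq_left (by omega)]
  push_cast
  field_simp
  ring

end Potentials

/-! ### Expected numbers of steps -/

section Steps

variable {V : Type*}

/-- The configurations of the Aldous-Broder phase. -/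
def aldousBroderPhase (V : Type*) : Set (Config V) := {s | ∃ x, s = .aldousBroder x}

/-- The configurations of Wilson's phase. -/
def wilsonPhase (V : Type*) : Set (Config V) := {s | ∃ T y, s = .wilson T y}

lemma mem_aldousBroderPhase (x : List V) : .aldousBroder x ∈ aldousBroderPhase V := ⟨x, rfl⟩

lemma mem_wilsonPhase (T : PartialTree V) (y : List V) : .wilson T y ∈ wilsonPhase V :=
  ⟨T, y, rfl⟩

lemma disjoint_phases : Disjoint (aldousBroderPhase V) (wilsonPhase V) := by
  rw [Set.disjoint_left]
  rintro _ ⟨x, rfl⟩ ⟨T, y, h⟩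
  cases h

lemma walkSteps_eq (ω : ℕ → Config V) :
    walkSteps ω = {t | ω t ∈ aldousBroderPhase V ∪ wilsonPhase V}.encard := by
  rw [walkSteps]
  congr 1
  ext t
  rcases h : ω t with x | ⟨T, y⟩ | T <;> simp [aldousBroderPhase, wilsonPhase, h]

variable [Fintype V] [DecidableEq V]

lemma card_of_sigmaIn_eq_top {x : List V} (hx : x ≠ []) (h : sigmaIn x 1 = ⊤) :
    1 ≤ x.toFinset.card ∧ x.toFinset.card < Fintype.card V := by
  refine ⟨by rwa [Nat.succ_le_iff, Finset.card_pos, List.toFinset_nonempty_iff], ?_⟩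
  rw [Finset.card_lt_iff_ne_univ, ne_eq, Finset.eq_univ_iff_forall]
  simpa only [List.mem_toFinset] using ((sigmaIn_one_eq_top_iff hx).1 h).1

lemma card_of_reachable {T : PartialTree V} {y : List V} (hy : y ≠ []) (hT : T.verts.Nonempty)
    (hd : Disjoint T.verts (loopErasure y).toFinset) :
    1 ≤ T.verts.card ∧ 1 ≤ (loopErasure y).length ∧
      T.verts.card + (loopErasure y).length ≤ Fintype.card V := by
  refine ⟨hT.card_pos, List.length_pos_iff.2 (loopErasure_ne_nil hy), ?_⟩
  rw [← List.toFinset_card_of_nodup (nodup_loopErasure y), ← Finset.card_union_of_disjoint hd]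
  exact Finset.card_le_univ _

lemma inv_mul_ofReal {n : ℕ} (hn : n ≠ 0) (c : ℝ) :
    (n : ℝ≥0∞)⁻¹ * ENNReal.ofReal (n * c) = ENNReal.ofReal c := by
  rw [ENNReal.ofReal_mul (Nat.cast_nonneg n), ENNReal.ofReal_natCast, ← mul_assoc,
    ENNReal.inv_mul_cancel (by exact_mod_cast hn) (ENNReal.natCast_ne_top n), one_mul]

lemma natCast_mul_ofReal (n : ℕ) (c : ℝ) :
    (n : ℝ≥0∞) * ENNReal.ofReal c = ENNReal.ofReal (n * c) := by
  rw [ENNReal.ofReal_mul (Nat.cast_nonneg n), ENNReal.ofReal_natCast]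

/-- The expected number of Wilson steps still to be taken from a configuration. -/
def wilsonPotential (V : Type*) [Fintype V] [DecidableEq V] : Config V → ℝ≥0∞ :=
  sizePotential (fun k => ENNReal.ofReal (walkPotential (Fintype.card V) k))
    fun k l => ENNReal.ofReal (branchPotential (Fintype.card V) k (l - 1))

lemma loopHeadPotential_branchPotential {n k : ℕ} (hn : n ≠ 0) :
    loopHeadPotential (fun k l => ENNReal.ofReal (branchPotential n k (l - 1))) n k =
      ENNReal.ofReal (treePotential n k) := by
  rw [loopHeadPotential]
  split_ifs with h
  · rw [h, treePotential_self hn, ENNReal.ofReal_zero]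
  · simp [branchPotential_zero]

/-- Equality matters: its two directions give the upper and the lower bound on the expected Wilson
steps. -/
lemma wilsonPotential_eq (h2 : 2 ≤ Fintype.card V) {s : Config V} (hs : s ∈ reachable) :
    wilsonPotential V s = (wilsonPhase V).indicator 1 s +
      (hybridStep (LoopGraph.complete V) 1 s).avg (wilsonPotential V) := by
  have hn : Fintype.card V ≠ 0 := by omega
  rcases s with x | ⟨T, y⟩ | T
  · obtain ⟨hx, h⟩ := hs
    obtain ⟨h1, hlt⟩ := card_of_sigmaIn_eq_top hx h
    have hmem : Config.aldousBroder x ∉ wilsonPhase V := by simp [wilsonPhase]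
    rw [Set.indicator_of_notMem hmem, zero_add, wilsonPotential, avg_step_aldousBroder hx h]
    simp only [loopHeadPotential_branchPotential hn, sizePotential]
    generalize x.toFinset.card = k at *
    generalize Fintype.card V = n at *
    -- If Aldous-Broder covers `V`, no Wilson step follows; both potentials are 0 at `n`, so this
    -- case needs no separate treatment.
    have hite : (if k + 1 = n then ENNReal.ofReal (treePotential n (k + 1))
        else ENNReal.ofReal (walkPotential n (k + 1))) =
        ENNReal.ofReal (walkPotential n (k + 1)) := by
      split_ifs with he
      · rw [he, treePotential_self hn, walkPotential, max_eq_left h2, sub_self]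
      · rfl
    have hpos : 0 ≤ walkPotential n (k + 1) := by
      rw [walkPotential, sub_nonneg]; exact_mod_cast max_le hlt h2
    have hsub : (0 : ℝ) ≤ (n : ℝ) - k := by
      rw [sub_nonneg]; exact_mod_cast hlt.le
    rw [hite, natCast_mul_ofReal (n - k), Nat.cast_sub hlt.le, ← inv_mul_ofReal hn (walkPotential n k)]
    congr 1
    split_ifs with hk
    · subst hk
      rw [inv_mul_ofReal hn, natCast_mul_ofReal, ← ENNReal.ofReal_add]
      · congr 1
        simp only [walkPotential, max_eq_right one_le_two, max_self, Nat.reduceAdd]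
        push_cast; ring
      · have : walkPotential n 1 = walkPotential n (1 + 1) := by simp [walkPotential]
        rw [this]; positivity
      · positivity
    · rw [natCast_mul_ofReal, ← ENNReal.ofReal_add, walkPotential_recurrence (by omega)]
      · exact mul_nonneg (Nat.cast_nonneg k) (treePotential_nonneg h1 hlt.le)
      · positivity
  · obtain ⟨hy, hT, hd⟩ := hs
    obtain ⟨hk, hl, hle⟩ := card_of_reachable hy hT hd
    rw [Set.indicator_of_mem (mem_wilsonPhase T y), wilsonPotential, avg_step_wilson hy hd]
    simp only [loopHeadPotential_branchPotential hn, sizePotential, Pi.one_apply,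
      Nat.add_sub_cancel]
    generalize (loopErasure y).length = l at *
    generalize T.verts.card = k at *
    generalize Fintype.card V = n at *
    obtain ⟨m, rfl⟩ := Nat.exists_eq_add_of_le' hl
    rw [Nat.add_sub_cancel]
    have hB : ∀ j ∈ Finset.range (m + 1), 0 ≤ branchPotential n k j := fun j hj =>
      branchPotential_nonneg hk (by have := Finset.mem_range.1 hj; omega)
    have hlast : 0 ≤ ((n - (k + (m + 1)) : ℕ) : ℝ) * branchPotential n k (m + 1) := by
      exact mul_nonneg (Nat.cast_nonneg _) (branchPotential_nonneg hk (by omega))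
    have hone : 0 ≤ branchPotential n k m - 1 := by
      have := sub_le_branchPotential (n := n) (m := m) hk (by omega)
      have : (k : ℝ) + (m + 1) ≤ n := by exact_mod_cast hle
      linarith
    rw [natCast_mul_ofReal, natCast_mul_ofReal, ← ENNReal.ofReal_sum_of_nonneg hB,
      ← ENNReal.ofReal_add (Finset.sum_nonneg hB) hlast, ← ENNReal.ofReal_add
        (mul_nonneg (Nat.cast_nonneg k) (treePotential_nonneg (by omega) hle))
        (add_nonneg (Finset.sum_nonneg hB) hlast), Nat.cast_sub hle]
    have hrec := branchPotential_recurrence (n := n) hk m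
    push_cast at hrec ⊢
    rw [hrec, inv_mul_ofReal hn, ← ENNReal.ofReal_one, ← ENNReal.ofReal_add zero_le_one hone]
    congr 1; ring
  · have hmem : Config.halted T ∉ wilsonPhase V := by simp [wilsonPhase]
    rw [Set.indicator_of_notMem hmem, wilsonPotential, avg_step_halted, zero_add]
    rfl

/-- The potential is positive in both phases, so the set `D` of `le_tsum_hybridProb` must be all
configurations that are not halted. -/
lemma wilsonPotential_le {s : Config V} (hs : s ∈ reachable) :
    wilsonPotential V s ≤ ENNReal.ofReal (2 * Fintype.card V) *
      (aldousBroderPhase V ∪ wilsonPhase V).indicator 1 s := by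
  rcases s with x | ⟨T, y⟩ | T
  · rw [Set.indicator_of_mem (Set.mem_union_left _ (mem_aldousBroderPhase x)), Pi.one_apply, mul_one]
    refine ENNReal.ofReal_le_ofReal ?_
    have h1 : (0 : ℝ) ≤ (max x.toFinset.card 2 : ℕ) := Nat.cast_nonneg _
    have h2 : (0 : ℝ) ≤ Fintype.card V := Nat.cast_nonneg _
    rw [walkPotential]
    linarith
  · rw [Set.indicator_of_mem (Set.mem_union_right _ (mem_wilsonPhase T y)), Pi.one_apply, mul_one]
    exact ENNReal.ofReal_le_ofReal (branchPotential_le hs.2.1.card_pos)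
  · exact zero_le

lemma aldousBroder_upper (h2 : 2 ≤ Fintype.card V) {s : Config V} (hs : s ∈ reachable) :
    (aldousBroderPhase V).indicator 1 s + (hybridStep (LoopGraph.complete V) 1 s).avg
        (sizePotential (fun k => ENNReal.ofReal (upperPotential (Fintype.card V) k)) fun _ _ => 0) ≤
      sizePotential (fun k => ENNReal.ofReal (upperPotential (Fintype.card V) k)) (fun _ _ => 0)
        s := by
  have hn : Fintype.card V ≠ 0 := by omega
  rcases s with x | ⟨T, y⟩ | T
  · obtain ⟨hx, h⟩ := hs
    obtain ⟨h1, hlt⟩ := card_of_sigmaIn_eq_top hx h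
    rw [Set.indicator_of_mem (mem_aldousBroderPhase x), avg_step_aldousBroder hx h]
    simp only [loopHeadPotential, sizePotential, ite_self, Pi.one_apply]
    generalize x.toFinset.card = k at *
    generalize Fintype.card V = n at *
    have hsub : (0 : ℝ) ≤ (n : ℝ) - k := by
      rw [sub_nonneg]; exact_mod_cast hlt.le
    have hU : ∀ j, 0 ≤ upperPotential n j := fun j => upperPotential_nonneg
    have hone : (1 : ℝ≥0∞) = (n : ℝ≥0∞)⁻¹ * ENNReal.ofReal n := by
      rw [ENNReal.ofReal_natCast, ENNReal.inv_mul_cancel (by exact_mod_cast hn)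
        (ENNReal.natCast_ne_top n)]
    have hite : (if k + 1 = n then 0 else ENNReal.ofReal (upperPotential n (k + 1))) ≤
        ENNReal.ofReal (upperPotential n (k + 1)) := by
      split_ifs
      · exact zero_le
      · exact le_rfl
    refine (add_le_add_right (mul_le_mul_right (add_le_add_right
      (mul_le_mul_right hite _) _) _) _).trans ?_
    rw [natCast_mul_ofReal (n - k), Nat.cast_sub hlt.le, hone, ← mul_add,
      ← inv_mul_ofReal hn (upperPotential n k)]
    refine mul_le_mul_right ?_ _
    have hlast := mul_nonneg hsub (hU (k + 1))
    split_ifs with hk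
    · subst hk
      rw [inv_mul_ofReal hn, natCast_mul_ofReal,
        ← ENNReal.ofReal_add (mul_nonneg (Nat.cast_nonneg 1) (hU 1)) hlast,
        ← ENNReal.ofReal_add (Nat.cast_nonneg n) (by have := hU 1; positivity)]
      refine ENNReal.ofReal_le_ofReal ?_
      simpa using upperPotential_recurrence_one h2
    · rw [mul_zero, zero_add, ← ENNReal.ofReal_add (Nat.cast_nonneg n) hlast]
      exact ENNReal.ofReal_le_ofReal (upperPotential_recurrence (by omega))
  · obtain ⟨hy, hT, hd⟩ := hs
    have hmem : Config.wilson T y ∉ aldousBroderPhase V := by simp [aldousBroderPhase]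
    rw [Set.indicator_of_notMem hmem, avg_step_wilson hy hd]
    simp [loopHeadPotential]
  · have hmem : Config.halted T ∉ aldousBroderPhase V := by simp [aldousBroderPhase]
    rw [Set.indicator_of_notMem hmem, avg_step_halted, zero_add]
    exact zero_le

lemma aldousBroder_lower (h2 : 2 ≤ Fintype.card V) {s : Config V} (hs : s ∈ reachable) :
    sizePotential (fun k => ENNReal.ofReal (lowerPotential (Fintype.card V) k)) (fun _ _ => 0) s ≤
      (aldousBroderPhase V).indicator 1 s + (hybridStep (LoopGraph.complete V) 1 s).avg
        (sizePotential (fun k => ENNReal.ofReal (lowerPotential (Fintype.card V) k))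
          fun _ _ => 0) := by
  have hn : Fintype.card V ≠ 0 := by omega
  rcases s with x | ⟨T, y⟩ | T
  · obtain ⟨hx, h⟩ := hs
    obtain ⟨h1, hlt⟩ := card_of_sigmaIn_eq_top hx h
    rw [Set.indicator_of_mem (mem_aldousBroderPhase x), avg_step_aldousBroder hx h]
    simp only [loopHeadPotential, sizePotential, ite_self, Pi.one_apply]
    generalize x.toFinset.card = k at *
    generalize Fintype.card V = n at *
    have hsub : (0 : ℝ) ≤ (n : ℝ) - k := by
      rw [sub_nonneg]; exact_mod_cast hlt.le
    have hL : ∀ j, 0 ≤ lowerPotential n j := fun j => lowerPotential_nonneg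
    have hone : (1 : ℝ≥0∞) = (n : ℝ≥0∞)⁻¹ * ENNReal.ofReal n := by
      rw [ENNReal.ofReal_natCast, ENNReal.inv_mul_cancel (by exact_mod_cast hn)
        (ENNReal.natCast_ne_top n)]
    have hite : (if k + 1 = n then 0 else ENNReal.ofReal (lowerPotential n (k + 1))) =
        ENNReal.ofReal (lowerPotential n (k + 1)) := by
      split_ifs with he
      · rw [he, lowerPotential_self, ENNReal.ofReal_zero]
      · rfl
    rw [hite, natCast_mul_ofReal (n - k), Nat.cast_sub hlt.le, hone, ← mul_add,
      ← inv_mul_ofReal hn (lowerPotential n k)]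
    refine mul_le_mul_right ?_ _
    have hlast := mul_nonneg hsub (hL (k + 1))
    split_ifs with hk
    · subst hk
      rw [inv_mul_ofReal hn, natCast_mul_ofReal,
        ← ENNReal.ofReal_add (mul_nonneg (Nat.cast_nonneg 1) (hL 1)) hlast,
        ← ENNReal.ofReal_add (Nat.cast_nonneg n) (by have := hL 1; positivity)]
      refine ENNReal.ofReal_le_ofReal ?_
      simpa using lowerPotential_recurrence_one (n := n) (by omega)
    · rw [mul_zero, zero_add, ← ENNReal.ofReal_add (Nat.cast_nonneg n) hlast]
      exact ENNReal.ofReal_le_ofReal lowerPotential_recurrence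
  · exact zero_le
  · exact zero_le

lemma lowerPotential_le_indicator (s : Config V) :
    sizePotential (fun k => ENNReal.ofReal (lowerPotential (Fintype.card V) k)) (fun _ _ => 0) s ≤
      ENNReal.ofReal √(Fintype.card V) * (aldousBroderPhase V).indicator 1 s := by
  rcases s with x | ⟨T, y⟩ | T
  · rw [Set.indicator_of_mem (mem_aldousBroderPhase x), Pi.one_apply, mul_one]
    exact ENNReal.ofReal_le_ofReal lowerPotential_le
  · exact zero_le
  · exact zero_le

variable (r : V)

theorem hybridExpect_aldousBroderSteps_le (h2 : 2 ≤ Fintype.card V) :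
    hybridExpect (LoopGraph.complete V) 1 r aldousBroderSteps ≤
      ENNReal.ofReal (4 * √(Fintype.card V)) := by
  have h := tsum_hybridProb_le (isHybridInvariant_reachable r)
    (fun s hs => aldousBroder_upper h2 hs)
  rw [avg_hybridInit h2, upperPotential_one (by omega)] at h
  exact (hybridExpect_encard (aldousBroderPhase V)).trans_le h

theorem le_hybridExpect_aldousBroderSteps (h2 : 2 ≤ Fintype.card V) :
    ENNReal.ofReal ((√(Fintype.card V) - 1) / 2) ≤
      hybridExpect (LoopGraph.complete V) 1 r aldousBroderSteps := by
  have hfin := hybridExpect_aldousBroderSteps_le r h2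
  rw [show hybridExpect (LoopGraph.complete V) 1 r aldousBroderSteps = _ from
    hybridExpect_encard (aldousBroderPhase V)] at hfin ⊢
  have h := le_tsum_hybridProb (isHybridInvariant_reachable r)
    (fun s hs => aldousBroder_lower h2 hs) ENNReal.ofReal_ne_top
    (fun s _ => lowerPotential_le_indicator s) (hfin.trans_lt ENNReal.ofReal_lt_top).ne
  rw [avg_hybridInit h2] at h
  refine (ENNReal.ofReal_le_ofReal ?_).trans h
  rw [lowerPotential]
  push_cast
  linarith [le_max_left (√(Fintype.card V : ℝ) - 1) 0]

theorem hybridExpect_wilsonSteps (h2 : 2 ≤ Fintype.card V) :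
    hybridExpect (LoopGraph.complete V) 1 r wilsonSteps =
      ENNReal.ofReal (Fintype.card V - 2) := by
  have hI := isHybridInvariant_reachable r
  have hinit : (hybridInit 1 r).avg (wilsonPotential V) =
      ENNReal.ofReal (Fintype.card V - 2) := by
    rw [wilsonPotential, avg_hybridInit h2, walkPotential]
    norm_num
  have hle : ∑' t, hybridProb (LoopGraph.complete V) 1 r (wilsonPhase V) t ≤ _ :=
    tsum_hybridProb_le hI fun s hs => (wilsonPotential_eq h2 hs).ge
  rw [hinit] at hle
  have hA := hybridExpect_aldousBroderSteps_le r h2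
  rw [show hybridExpect (LoopGraph.complete V) 1 r aldousBroderSteps = _ from
    hybridExpect_encard (aldousBroderPhase V)] at hA
  -- The upper bounds for the two phases supply the finiteness that the lower bound requires.
  refine (hybridExpect_encard (wilsonPhase V)).trans (le_antisymm hle ?_)
  rw [← hinit]
  refine le_tsum_hybridProb hI (fun s hs => (wilsonPotential_eq h2 hs).le)
    ENNReal.ofReal_ne_top (fun s hs => wilsonPotential_le hs) ?_
  rw [← hybridExpect_encard, hybridExpect_add disjoint_phases]
  exact ENNReal.add_ne_top.2 ⟨(hA.trans_lt ENNReal.ofReal_lt_top).ne,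
    (hle.trans_lt ENNReal.ofReal_lt_top).ne⟩

theorem hybridExpect_walkSteps :
    hybridExpect (LoopGraph.complete V) 1 r walkSteps =
      hybridExpect (LoopGraph.complete V) 1 r aldousBroderSteps +
        hybridExpect (LoopGraph.complete V) 1 r wilsonSteps := by
  rw [show (walkSteps : (ℕ → Config V) → ℕ∞) = _ from funext walkSteps_eq,
    hybridExpect_add disjoint_phases, ← hybridExpect_encard, ← hybridExpect_encard]
  rfl

end Steps

end

/-! ### Choice of constants and conclusion -/

theorem mainTheorem5 :
    (∃ c C : ℝ, 0 < c ∧ 0 < C ∧ ∃ N : ℕ,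
      ∀ (V : Type*) [Fintype V] [DecidableEq V] (r : V), N ≤ Fintype.card V →
        (ENNReal.ofReal (Fintype.card V + c * √(Fintype.card V)) ≤
            hybridExpect (LoopGraph.complete V) 1 r walkSteps ∧
          hybridExpect (LoopGraph.complete V) 1 r walkSteps ≤
            ENNReal.ofReal (Fintype.card V + C * √(Fintype.card V))) ∧
        (ENNReal.ofReal (c * √(Fintype.card V)) ≤
            hybridExpect (LoopGraph.complete V) 1 r aldousBroderSteps ∧
          hybridExpect (LoopGraph.complete V) 1 r aldousBroderSteps ≤
            ENNReal.ofReal (C * √(Fintype.card V)))) ∧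
    (∀ (V : Type*) [Fintype V] [DecidableEq V] (r : V), 2 ≤ Fintype.card V →
      hybridExpect (LoopGraph.complete V) 1 r wilsonSteps =
        ENNReal.ofReal (Fintype.card V - 2)) := by
  -- The lower bound on the total needs (√n - 1)/2 - 2 ≥ √n/4, that is √n ≥ 10, whence the threshold
  -- 100. The 4 is the value of `upperPotential` at k = 1 divided by √n.
  refine ⟨⟨1 / 4, 4, by norm_num, by norm_num, 100, fun V _ _ r hN => ?_⟩,
    fun V _ _ r h2 => hybridExpect_wilsonSteps r h2⟩
  have h2 : 2 ≤ Fintype.card V := by omega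
  have hsqrt : 10 ≤ √(Fintype.card V : ℝ) := by
    rw [Real.le_sqrt' (by norm_num)]
    norm_num
    exact_mod_cast hN
  have hcard : (100 : ℝ) ≤ Fintype.card V := by exact_mod_cast hN
  have hup := hybridExpect_aldousBroderSteps_le r h2
  have hlow := le_hybridExpect_aldousBroderSteps r h2
  rw [hybridExpect_walkSteps, hybridExpect_wilsonSteps r h2]
  refine ⟨⟨?_, ?_⟩, ?_, hup⟩
  · refine le_trans ?_ (add_le_add_left hlow _)
    rw [← ENNReal.ofReal_add (by linarith) (by linarith)]
    exact ENNReal.ofReal_le_ofReal (by linarith)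
  · refine (add_le_add_left hup _).trans ?_
    rw [← ENNReal.ofReal_add (by positivity) (by linarith)]
    exact ENNReal.ofReal_le_ofReal (by linarith)
  · exact (ENNReal.ofReal_le_ofReal (by linarith)).trans hlow
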